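/- **Setting.** A (unitary) rational conformal model with finite set of primaries $P$ and vacuum $0\in P$ is considered through its modular data: a symmetric unitary matrix $S=(S_{pq})_{p,q\in P}$ with $S_{0p}>0$ for all $p$, such that the fusion rule coefficients $N_{pq}^r=\sum_s S_{ps}S_{qs}\overline{S_{rs}}/S_{0s}$ are non-negative integers. The quantum dimensions are $d_p=S_{0p}/S_{00}$, and $p\in P$ corresponds to the irreducible representation $\rho_p(\alpha)=S_{\alpha p}/S_{0p}$ of the fusion algebra. The deconstruction lattice $\mathscr L$ consists of all $\mathfrak g\subseteq P$ with $0\in\mathfrak g$ that are closed under fusion ($p,q\in\mathfrak g$ and $N_{pq}^r>0$ imply $r\in\mathfrak g$), ordered by inclusion; the meet is intersection, and the join of two elements is the smallest element of $\mathscr L$ containing both. For $\mathfrak g\in\mathscr L$, the $\mathfrak g$-classes are the classes of the equivalence relation $\rho_p|_{\mathfrak g}=\rho_q|_{\mathfrak g}$ on $P$, and $\mathfrak g^\perp\in\mathscr L$ is the $\mathfrak g$-class of $0$ (the trivial class); one has $\mathfrak g^{\perp\perp}=\mathfrak g$. The center $\mathtt Z(\mathfrak g)$ is the set of central classes, i.e.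 the $\mathfrak g$-classes $C$ of minimal mass $\sum_{p\in C}d_p^2$. It is an abelian group under the fusion product of classes $C_1C_2=\{r : N_{pq}^r>0 \text{ for some } p\in C_1,\ q\in C_2\}$, with identity $\mathfrak g^\perp$. For a subgroup $H\le\mathtt Z(\mathfrak g)$, the central quotient $\mathfrak g/H\in\mathscr L$ is the element with $(\mathfrak g/H)^\perp=\bigcup_{\mathsf z\in H}\mathsf z$; the maximal central quotient is $\boldsymbol\partial\mathfrak g=\mathfrak g/\mathtt Z(\mathfrak g)$. For $\mathfrak h\subseteq\mathfrak g$, let $\mathtt Z(\mathfrak g|\mathfrak h)\le \mathtt Z(\mathfrak g)$ and $\mathtt I(\mathfrak g|\mathfrak h)\le\mathtt Z(\mathfrak h)$ be the kernel and the image of the restriction homomorphism $\mathtt Z(\mathfrak g)\to\mathtt Z(\mathfrak h)$, which maps a central $\mathfrak g$-class to the central $\mathfrak h$-class containing it; thus $\mathtt Z(\mathfrak g|\mathfrak h)=\{\mathsf z\in\mathtt Z(\mathfrak g):\mathsf z\subseteq\mathfrak h^\perp\}$. **Lemma.** Let $\mathfrak g\in\mathscr L$. 1. If $\mathfrak h_1$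 and $\mathfrak h_2$ are both central quotients of $\mathfrak g$, then $\mathtt Z(\mathfrak g|\mathfrak h_1)\,\mathtt Z(\mathfrak g|\mathfrak h_2)=\mathtt Z(\mathfrak g|\mathfrak h_1\cap\mathfrak h_2)$. 2. For all subgroups $H_1,H_2\le\mathtt Z(\mathfrak g)$ one has $(\mathfrak g/H_1)\vee(\mathfrak g/H_2)=\mathfrak g/(H_1\cap H_2)$ and $(\mathfrak g/H_1)\cap(\mathfrak g/H_2)=\mathfrak g/(H_1H_2)$. 3. Consequently, the Galois correspondences are (order-reversing) lattice isomorphisms: if $\mathfrak h$ is a central quotient of $\mathfrak g$, then (a) $\mathfrak j\mapsto\mathtt Z(\mathfrak g|\mathfrak j)$ is an isomorphism from the interval $\{\mathfrak j\in\mathscr L:\mathfrak h\subseteq\mathfrak j\subseteq\mathfrak g\}$ onto the dual (opposite) of the lattice of subgroups of $\mathtt Z(\mathfrak g|\mathfrak h)$, with inverse $H\mapsto\mathfrak g/H$; (b) $\mathfrak j\mapsto\mathtt Z(\mathfrak h|\mathfrak j)$ is an isomorphism from the interval $\{\mathfrak j\in\mathscr L:\boldsymbol\partial\mathfrak g\subseteq\mathfrak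 j\subseteq\mathfrak h\}$ onto the dual (opposite) of the lattice of subgroups of $\mathtt I(\mathfrak g|\mathfrak h)$, with inverse $H\mapsto\mathfrak h/H$. -/

import Mathlib

open scoped Pointwise ComplexConjugate

noncomputable section

/-- The modular data of a unitary rational conformal model with finite set `P` of primaries: the
vacuum, the modular `S`-matrix (symmetric and unitary, with positive vacuum row) and the fusion
rule coefficients `N p q r` (the multiplicity of `r` in the fusion product of `p` and `q`), which
are natural numbers related to `S` by Verlinde's formula. -/
structure ConformalModel (P : Type*) [Fintype P] [DecidableEq P] where
  vac : P
  S : Matrix P P ℂ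
  N : P → P → P → ℕ
  S_symm : ∀ p q, S p q = S q p
  S_unitary : S ∈ Matrix.unitaryGroup P ℂ
  vac_im : ∀ p, (S vac p).im = 0
  vac_pos : ∀ p, 0 < (S vac p).re
  verlinde : ∀ p q r, (N p q r : ℂ) = ∑ s, S p s * S q s * conj (S r s) / S vac s

namespace ConformalModel

variable {P : Type*} [Fintype P] [DecidableEq P] (M : ConformalModel P)

/-- The quantum dimension of a primary. -/
def qdim (p : P) : ℝ := (M.S M.vac p).re / (M.S M.vac M.vac).re

/-- The irreducible representation of the fusion algebra corresponding to the primary `p`,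
evaluated on the basis element `α`. -/
def irrep (p α : P) : ℂ := M.S α p / M.S M.vac p

/-- The elements of the deconstruction lattice: sets of primaries that contain the vacuum and are
closed under the fusion product. -/
@[ext]
structure Lat where
  carrier : Set P
  vac_mem : M.vac ∈ carrier
  fusion_mem : ∀ {p q r : P}, p ∈ carrier → q ∈ carrier → 0 < M.N p q r → r ∈ carrier

variable {M}

instance : SetLike M.Lat P where
  coe := Lat.carrier
  coe_injective _ _ h := Lat.ext h

/-- The deconstruction lattice is ordered by inclusion; the meet is the intersection. -/
instance : Lattice M.Lat where
  le g h := ∀ ⦃p⦄, p ∈ g → p ∈ h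
  le_refl _ _ hp := hp
  le_trans _ _ _ h₁ h₂ _ hp := h₂ (h₁ hp)
  le_antisymm _ _ h₁ h₂ := SetLike.ext fun _ => ⟨fun hp => h₁ hp, fun hp => h₂ hp⟩
  inf g h :=
    { carrier := (g : Set P) ∩ (h : Set P)
      vac_mem := ⟨g.vac_mem, h.vac_mem⟩
      fusion_mem := fun hp hq hN =>
        ⟨g.fusion_mem hp.1 hq.1 hN, h.fusion_mem hp.2 hq.2 hN⟩ }
  inf_le_left _ _ _ hp := hp.1
  inf_le_right _ _ _ hp := hp.2
  le_inf _ _ _ h₁ h₂ _ hp := ⟨h₁ hp, h₂ hp⟩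
  sup g h :=
    { carrier := {p | ∀ k : M.Lat, (∀ q ∈ g, q ∈ k) → (∀ q ∈ h, q ∈ k) → p ∈ k}
      vac_mem := fun k _ _ => k.vac_mem
      fusion_mem := fun hp hq hN k hg hh =>
        k.fusion_mem (hp k hg hh) (hq k hg hh) hN }
  le_sup_left _ _ p hp _ hg _ := hg p hp
  le_sup_right _ _ p hp _ _ hh := hh p hp
  sup_le _ _ k h₁ h₂ _ hp := hp k (fun _ hq => h₁ hq) (fun _ hq => h₂ hq)

/-! ### Basic facts on the modular data -/

section Basic

/-- The vacuum row of the `S`-matrix, as real numbers. -/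
def v (M : ConformalModel P) (p : P) : ℝ := (M.S M.vac p).re

lemma v_pos (p : P) : 0 < M.v p := M.vac_pos p

lemma S_vac (p : P) : M.S M.vac p = (M.v p : ℂ) :=
  Complex.ext (by simp [v]) (by simp [M.vac_im p])

lemma S_vac' (p : P) : M.S p M.vac = (M.v p : ℂ) := by rw [M.S_symm, S_vac]

lemma vC_ne (p : P) : (M.v p : ℂ) ≠ 0 := by exact_mod_cast (v_pos p).ne'

lemma orth (p q : P) : ∑ s, M.S p s * conj (M.S q s) = if p = q then 1 else 0 := by
  have h := congrFun (congrFun (Matrix.mem_unitaryGroup_iff.1 M.S_unitary) p) q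
  simpa [Matrix.mul_apply, Matrix.one_apply, Matrix.star_apply] using h

lemma orth' (p q : P) : ∑ s, M.S s p * conj (M.S s q) = if p = q then 1 else 0 := by
  simp_rw [fun s => M.S_symm s p, fun s => M.S_symm s q]
  exact orth p q

lemma fus (p q s : P) : ∑ r, (M.N p q r : ℂ) * M.S r s = M.S p s * M.S q s / M.v s := by
  simp_rw [M.verlinde, Finset.sum_mul]
  rw [Finset.sum_comm]
  have : ∀ t, ∑ r, M.S p t * M.S q t * conj (M.S r t) / M.S M.vac t * M.S r s
      = M.S p t * M.S q t / M.S M.vac t * (if s = t then 1 else 0) := by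
    intro t
    rw [← orth' (M := M) s t, Finset.mul_sum]
    exact Finset.sum_congr rfl fun r _ => by ring
  simp_rw [this]
  simp [S_vac]

lemma fus_dim (p q : P) : ∑ r, (M.N p q r : ℝ) * M.v r = M.v p * M.v q / M.v M.vac := by
  have := fus (M := M) p q M.vac
  simp_rw [S_vac'] at this
  exact_mod_cast this

lemma fus_dim' (p r : P) : ∑ q, (M.N p q r : ℝ) * M.v q = M.v p * M.v r / M.v M.vac := by
  have : ∑ q, (M.N p q r : ℂ) * M.v q = M.v p * M.v r / M.v M.vac := by
    simp_rw [M.verlinde, Finset.sum_mul]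
    rw [Finset.sum_comm]
    have : ∀ t, ∑ q, M.S p t * M.S q t * conj (M.S r t) / M.S M.vac t * (M.v q : ℂ)
        = M.S p t * conj (M.S r t) / M.S M.vac t * (if t = M.vac then 1 else 0) := by
      intro t
      rw [← orth' (M := M) t M.vac, Finset.mul_sum]
      refine Finset.sum_congr rfl fun q _ => ?_
      rw [S_vac', Complex.conj_ofReal]; ring
    simp_rw [this]
    simp [S_vac, S_vac']
  exact_mod_cast this

lemma bound (p s : P) : ‖M.S p s‖ * M.v M.vac ≤ M.v p * M.v s := by
  have h0 := v_pos (M := M) M.vac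
  have hs := v_pos (M := M) s
  have key : ∀ q, ‖M.S p s‖ / M.v s * ‖M.S q s‖ ≤ ∑ r, (M.N p q r : ℝ) * ‖M.S r s‖ := by
    intro q
    have h : ‖M.S p s‖ / M.v s * ‖M.S q s‖ = ‖∑ r, (M.N p q r : ℂ) * M.S r s‖ := by
      rw [fus, norm_div, norm_mul, Complex.norm_real, Real.norm_of_nonneg hs.le]; ring
    rw [h]
    refine (norm_sum_le _ _).trans (le_of_eq ?_)
    simp
  have hT : 0 < ∑ q, ‖M.S q s‖ * M.v q := by
    refine Finset.sum_pos' (fun q _ => mul_nonneg (norm_nonneg _) (v_pos q).le)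
      ⟨M.vac, Finset.mem_univ _, ?_⟩
    rw [S_vac, Complex.norm_real, Real.norm_of_nonneg hs.le]
    exact mul_pos hs h0
  have h1 : ‖M.S p s‖ / M.v s * ∑ q, ‖M.S q s‖ * M.v q
      ≤ M.v p / M.v M.vac * ∑ q, ‖M.S q s‖ * M.v q := by
    calc ‖M.S p s‖ / M.v s * ∑ q, ‖M.S q s‖ * M.v q
        = ∑ q, (‖M.S p s‖ / M.v s * ‖M.S q s‖) * M.v q := by
          rw [Finset.mul_sum]; exact Finset.sum_congr rfl fun _ _ => by ring
      _ ≤ ∑ q, (∑ r, (M.N p q r : ℝ) * ‖M.S r s‖) * M.v q :=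
          Finset.sum_le_sum fun q _ => mul_le_mul_of_nonneg_right (key q) (v_pos q).le
      _ = ∑ r, ‖M.S r s‖ * ∑ q, (M.N p q r : ℝ) * M.v q := by
          simp_rw [Finset.sum_mul, Finset.mul_sum]
          rw [Finset.sum_comm]
          exact Finset.sum_congr rfl fun _ _ => Finset.sum_congr rfl fun _ _ => by ring
      _ = _ := by
          simp_rw [fus_dim', Finset.mul_sum]
          exact Finset.sum_congr rfl fun _ _ => by ring
  have h2 := le_of_mul_le_mul_right h1 hT
  rwa [div_le_div_iff₀ hs h0] at h2

/-- The normalized value `χ_p(α) / d_α`; for `p` in a central `g`-class and `α ∈ g` this is the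
central character of the class. -/
def cc (M : ConformalModel P) (p α : P) : ℂ := M.S α p * M.v M.vac / (M.v α * M.v p)

lemma cc_comm (p α : P) : M.cc p α = M.cc α p := by
  rw [cc, cc, M.S_symm, mul_comm (M.v p : ℂ)]

lemma cc_norm_le (p α : P) : ‖M.cc p α‖ ≤ 1 := by
  have h0 := v_pos (M := M) M.vac
  have hs := v_pos (M := M) α
  have hp := v_pos (M := M) p
  rw [cc, norm_div, norm_mul, norm_mul]
  simp only [Complex.norm_real, Real.norm_of_nonneg h0.le, Real.norm_of_nonneg hs.le,
    Real.norm_of_nonneg hp.le]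
  exact div_le_one_of_le₀ (bound α p) (by positivity)

lemma cc_vac (α : P) : M.cc M.vac α = 1 := by
  rw [cc, S_vac']
  exact div_self (mul_ne_zero (vC_ne _) (vC_ne _))

lemma S_eq (α p : P) : M.S α p = M.cc p α * (M.v α * M.v p) / M.v M.vac := by
  have := vC_ne (M := M) M.vac
  have := vC_ne (M := M) α
  have := vC_ne (M := M) p
  rw [cc]; field_simp

lemma irrep_eq (p α : P) : M.irrep p α = M.cc p α * (M.v α / M.v M.vac) := by
  have := vC_ne (M := M) p
  rw [irrep, S_eq, S_vac]; field_simp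

lemma irrep_inj {p q α : P} : M.irrep p α = M.irrep q α ↔ M.cc p α = M.cc q α := by
  rw [irrep_eq, irrep_eq]
  exact mul_left_inj' (div_ne_zero (vC_ne _) (vC_ne _))

lemma eq_of_avg {ι : Type*} [Fintype ι] {w : ι → ℝ} {z : ι → ℂ} {u : ℂ} (hw : ∀ i, 0 ≤ w i)
    (hz : ∀ i, ‖z i‖ ≤ 1) (hu : ‖u‖ = 1) (h : ∑ i, (w i : ℂ) * z i = u * ∑ i, (w i : ℂ))
    {i : ι} (hi : 0 < w i) : z i = u := by
  have hcu : conj u * u = 1 := by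
    rw [mul_comm, Complex.mul_conj, Complex.normSq_eq_norm_sq, hu]; simp
  have hz' : ∀ j, (conj u * z j).re ≤ 1 := fun j =>
    (Complex.re_le_norm _).trans (by rw [norm_mul, RCLike.norm_conj, hu, one_mul]; exact hz j)
  have h1 : ∑ j, w j * (1 - (conj u * z j).re) = 0 := by
    have h2 : conj u * ∑ j, (w j : ℂ) * z j = ∑ j, (w j : ℂ) := by
      rw [h, ← mul_assoc, hcu, one_mul]
    have h3 := congrArg Complex.re h2
    rw [Finset.mul_sum, Complex.re_sum, Complex.re_sum] at h3
    simp_rw [mul_sub, Finset.sum_sub_distrib, mul_one]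
    rw [sub_eq_zero]
    simp only [Complex.ofReal_re] at h3
    rw [← h3]
    refine Finset.sum_congr rfl fun j _ => ?_
    rw [mul_left_comm, Complex.re_ofReal_mul]
  have h4 := (Finset.sum_eq_zero_iff_of_nonneg
    (fun j _ => mul_nonneg (hw j) (sub_nonneg.2 (hz' j)))).1 h1 i (Finset.mem_univ _)
  have h5 : (conj u * z i).re = 1 := by
    rcases mul_eq_zero.1 h4 with h | h
    · exact absurd h hi.ne'
    · linarith
  have h6 : ‖conj u * z i‖ ≤ 1 := by rw [norm_mul, RCLike.norm_conj, hu, one_mul]; exact hz i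
  have h7 : conj u * z i = 1 := by
    have h8 : (conj u * z i).re ^ 2 + (conj u * z i).im ^ 2 ≤ 1 := by
      have := Complex.sq_norm (conj u * z i)
      rw [Complex.normSq_apply] at this
      nlinarith [norm_nonneg (conj u * z i)]
    refine Complex.ext (by simpa using h5) ?_
    rw [h5] at h8
    simp only [Complex.one_im]
    nlinarith
  calc z i = (conj u * u) * z i := by rw [hcu, one_mul]
    _ = u * (conj u * z i) := by ring
    _ = u := by rw [h7, mul_one]

lemma cc_fusion {p q r α : P} (hp : ‖M.cc p α‖ = 1) (hq : ‖M.cc q α‖ = 1) (hN : 0 < M.N p q r) :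
    M.cc r α = M.cc p α * M.cc q α := by
  refine eq_of_avg (w := fun r => (M.N p q r : ℝ) * M.v r) (z := fun r => M.cc r α)
    (fun i => mul_nonneg (Nat.cast_nonneg _) (v_pos i).le) (fun i => cc_norm_le i α)
    (by rw [norm_mul, hp, hq, one_mul]) ?_
    (mul_pos (by exact_mod_cast hN) (v_pos r))
  have h0 := vC_ne (M := M) M.vac
  have ha := vC_ne (M := M) α
  have h1 := fus (M := M) p q α
  have h2 : ∑ i, (((M.N p q i : ℝ) * M.v i : ℝ) : ℂ) = M.v p * M.v q / M.v M.vac := by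
    exact_mod_cast fus_dim (M := M) p q
  rw [h2]
  have h3 : ∀ i, (M.N p q i : ℂ) * M.S i α
      = (((M.N p q i : ℝ) * M.v i : ℝ) : ℂ) * M.cc i α * (M.v α / M.v M.vac) := by
    intro i
    rw [M.S_symm, S_eq]; push_cast; ring
  simp_rw [h3] at h1
  rw [← Finset.sum_mul, M.S_symm p, M.S_symm q, S_eq, S_eq] at h1
  have h4 : (M.v α / M.v M.vac : ℂ) ≠ 0 := div_ne_zero ha h0
  apply mul_right_cancel₀ h4
  rw [h1]; field_simp

lemma exists_fusion (p q : P) : ∃ r, 0 < M.N p q r := by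
  by_contra! h
  have h1 := fus_dim (M := M) p q
  have h2 : ∀ r, M.N p q r = 0 := fun r => Nat.le_zero.1 (h r)
  simp only [h2, Nat.cast_zero, zero_mul, Finset.sum_const_zero] at h1
  have h3 : 0 < M.v p * M.v q / M.v M.vac := by
    have := v_pos (M := M) p
    have := v_pos (M := M) q
    have := v_pos (M := M) M.vac
    positivity
  exact h3.ne h1

lemma N_comm (p q r : P) : M.N p q r = M.N q p r := by
  have : (M.N p q r : ℂ) = M.N q p r := by
    rw [M.verlinde, M.verlinde]; exact Finset.sum_congr rfl fun _ _ => by ring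
  exact_mod_cast this

lemma N_vac (p : P) : M.N M.vac p p = 1 := by
  have : (M.N M.vac p p : ℂ) = 1 := by
    rw [M.verlinde]
    have h := orth (M := M) p p
    rw [if_pos rfl] at h
    rw [← h]
    refine Finset.sum_congr rfl fun s _ => ?_
    have := vC_ne (M := M) s
    rw [S_vac]; field_simp
  exact_mod_cast this

lemma N_to_vac (p q : P) : (M.N p q M.vac : ℂ) = ∑ s, M.S p s * M.S q s := by
  rw [M.verlinde]
  refine Finset.sum_congr rfl fun s _ => ?_
  have := vC_ne (M := M) s
  rw [S_vac, Complex.conj_ofReal]; field_simp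

lemma sum_N_vac_sq (p : P) : ∑ q, M.N p q M.vac * M.N p q M.vac = 1 := by
  have h1 : ∀ s, ∑ q, (M.N p q M.vac : ℂ) * conj (M.S q s) = M.S p s := by
    intro s
    simp_rw [N_to_vac, Finset.sum_mul]
    rw [Finset.sum_comm]
    have : ∀ t, ∑ q, M.S p t * M.S q t * conj (M.S q s)
        = M.S p t * (if t = s then 1 else 0) := by
      intro t
      rw [← orth' (M := M) t s, Finset.mul_sum]
      exact Finset.sum_congr rfl fun _ _ => by ring
    simp_rw [this]; simp
  have h2 : ∑ q, (M.N p q M.vac : ℂ) * M.N p q M.vac = 1 := by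
    have h3 : ∀ q, (M.N p q M.vac : ℂ) = ∑ s, conj (M.S p s) * conj (M.S q s) := by
      intro q
      have := congrArg conj (N_to_vac (M := M) p q)
      simpa [map_sum] using this
    calc ∑ q, (M.N p q M.vac : ℂ) * M.N p q M.vac
        = ∑ q, (M.N p q M.vac : ℂ) * ∑ s, conj (M.S p s) * conj (M.S q s) :=
          Finset.sum_congr rfl fun q _ => by rw [← h3]
      _ = ∑ s, (∑ q, (M.N p q M.vac : ℂ) * conj (M.S q s)) * conj (M.S p s) := by
          simp_rw [Finset.mul_sum, Finset.sum_mul]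
          rw [Finset.sum_comm]
          exact Finset.sum_congr rfl fun _ _ => Finset.sum_congr rfl fun _ _ => by ring
      _ = 1 := by simp_rw [h1]; simp [orth]
  exact_mod_cast h2

lemma exists_conj (p : P) : ∃ q, 0 < M.N p q M.vac := by
  by_contra! h
  have h1 := sum_N_vac_sq (M := M) p
  simp [fun q => Nat.le_zero.1 (h q)] at h1

lemma S_conj {p q : P} (h : 0 < M.N p q M.vac) (s : P) : M.S q s = conj (M.S p s) := by
  have h1 := sum_N_vac_sq (M := M) p
  rw [← Finset.add_sum_erase _ _ (Finset.mem_univ q)] at h1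
  have h2 : 1 ≤ M.N p q M.vac * M.N p q M.vac := Nat.mul_pos h h
  have h3 : ∀ t, t ≠ q → M.N p t M.vac = 0 := by
    have : ∑ t ∈ Finset.univ.erase q, M.N p t M.vac * M.N p t M.vac = 0 := by omega
    intro t ht
    have := (Finset.sum_eq_zero_iff.1 this) t (by simp [ht])
    simpa using this
  have h4 : M.N p q M.vac = 1 := by
    have : M.N p q M.vac * M.N p q M.vac = 1 := by omega
    exact Nat.eq_one_of_mul_eq_one_left this
  have h5 : ∑ t, (M.N p t M.vac : ℂ) * conj (M.S t s) = M.S p s := by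
    simp_rw [N_to_vac, Finset.sum_mul]
    rw [Finset.sum_comm]
    have : ∀ t, ∑ q, M.S p t * M.S q t * conj (M.S q s)
        = M.S p t * (if t = s then 1 else 0) := by
      intro t
      rw [← orth' (M := M) t s, Finset.mul_sum]
      exact Finset.sum_congr rfl fun _ _ => by ring
    simp_rw [this]; simp
  rw [Finset.sum_eq_single q (fun t _ ht => by simp [h3 t ht]) (by simp), h4] at h5
  rw [← h5]; simp

lemma cc_conj {p q : P} (h : 0 < M.N p q M.vac) (α : P) : M.cc q α = conj (M.cc p α) := by
  have hv : M.v q = M.v p := by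
    have := S_conj h M.vac
    rw [S_vac', S_vac', Complex.conj_ofReal] at this
    exact_mod_cast this
  rw [cc, cc, M.S_symm, S_conj h, hv, M.S_symm p]
  simp

lemma N_conj {p q : P} (h : 0 < M.N p q M.vac) (r t : P) : M.N q r t = M.N p t r := by
  have h1 : conj (M.N p t r : ℂ) = (M.N q r t : ℂ) := by
    rw [M.verlinde, M.verlinde, map_sum]
    refine Finset.sum_congr rfl fun s _ => ?_
    rw [S_conj h, S_vac]
    simp; ring
  rw [Complex.conj_natCast] at h1
  exact_mod_cast h1.symm

/-- Elements of the deconstruction lattice are also closed under left division. -/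
lemma Lat.div_mem (g : M.Lat) {β α γ : P} (hβ : β ∈ g) (hγ : γ ∈ g) (hN : 0 < M.N β α γ) :
    α ∈ g := by
  classical
  by_contra hα
  let G : Finset P := Finset.univ.filter (· ∈ g)
  have hG : ∀ {x}, x ∈ G ↔ x ∈ g := by simp [G]
  have e1 : ∑ a ∈ G, M.v a * ∑ c ∈ G, (M.N β a c : ℝ) * M.v c
      = ∑ a ∈ G, M.v a * (M.v β * M.v a / M.v M.vac) := by
    refine Finset.sum_congr rfl fun a ha => ?_
    rw [← fus_dim]
    congr 1
    refine Finset.sum_subset (Finset.subset_univ _) fun c _ hc => ?_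
    have : M.N β a c = 0 := by
      by_contra h
      exact hc (hG.2 (g.fusion_mem hβ (hG.1 ha) (Nat.pos_of_ne_zero h)))
    simp [this]
  have e2 : ∑ a ∈ G, M.v a * ∑ c ∈ G, (M.N β a c : ℝ) * M.v c
      = ∑ c ∈ G, M.v c * ∑ a ∈ G, (M.N β a c : ℝ) * M.v a := by
    simp_rw [Finset.mul_sum]
    rw [Finset.sum_comm]
    exact Finset.sum_congr rfl fun _ _ => Finset.sum_congr rfl fun _ _ => by ring
  have e3 : ∑ c ∈ G, M.v c * ∑ a ∈ G, (M.N β a c : ℝ) * M.v a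
      < ∑ c ∈ G, M.v c * (M.v β * M.v c / M.v M.vac) := by
    refine Finset.sum_lt_sum (fun c _ => ?_) ⟨γ, hG.2 hγ, ?_⟩
    · rw [← fus_dim']
      exact mul_le_mul_of_nonneg_left (Finset.sum_le_univ_sum_of_nonneg
        fun a => mul_nonneg (Nat.cast_nonneg _) (v_pos a).le) (v_pos c).le
    · rw [← fus_dim']
      refine mul_lt_mul_of_pos_left ?_ (v_pos γ)
      exact Finset.sum_lt_sum_of_subset (Finset.subset_univ G) (Finset.mem_univ α)
        (fun h => hα (hG.1 h)) (mul_pos (by exact_mod_cast hN) (v_pos α))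
        (fun a _ _ => mul_nonneg (Nat.cast_nonneg _) (v_pos a).le)
  rw [← e2, e1] at e3
  exact lt_irrefl _ e3

lemma Lat.conj_mem (g : M.Lat) {p q : P} (hp : p ∈ g) (h : 0 < M.N p q M.vac) : q ∈ g :=
  g.div_mem hp g.vac_mem h

end Basic

/-! ### Classes, duality and the center -/

/-- The `g`-class of the primary `p`: all primaries `q` such that the irreducible representations
of the fusion algebra corresponding to `p` and `q` coincide on the elements of `g`. -/
def Lat.cls (g : M.Lat) (p : P) : Set P := {q | ∀ α ∈ g, M.irrep q α = M.irrep p α}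

variable (M) in
/-- For a set `X` of primaries, the set of all `p` whose irreducible representation coincides with
that of the vacuum on `X`. It is an element of the deconstruction lattice. -/
def perp (X : Set P) : M.Lat where
  carrier := {p | ∀ α ∈ X, M.irrep p α = M.irrep M.vac α}
  vac_mem := fun _ _ => rfl
  fusion_mem := by
    intro p q r hp hq hN α hα
    have h1 := hp α hα
    have h2 := hq α hα
    rw [irrep_inj, cc_vac] at h1 h2 ⊢
    rw [cc_fusion (by rw [h1, norm_one]) (by rw [h2, norm_one]) hN, h1, h2, one_mul]

/-- The trivial class `g^⊥`, i.e. the `g`-class of the vacuum, as an element of the lattice. -/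
def Lat.dual (g : M.Lat) : M.Lat := M.perp g

variable (M) in
/-- The mass of a set of primaries: the sum of the squares of the quantum dimensions. -/
def mass (z : Set P) : ℝ := ∑ p, z.indicator (fun p => M.qdim p ^ 2) p

/-- The central `g`-classes: those `g`-classes whose mass is minimal. -/
def Lat.IsCentral (g : M.Lat) (z : Set P) : Prop :=
  (∃ p, z = g.cls p) ∧ ∀ q, M.mass z ≤ M.mass (g.cls q)

/-- The center `Z(g)`: the collection of all central `g`-classes. -/
def Lat.Center (g : M.Lat) : Type _ := {z : Set P // g.IsCentral z}

variable (M) in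
/-- The set of all primaries occurring in a fusion product of an element of `A` with one of `B`. -/
def fuse (A B : Set P) : Set P := {r | ∃ p ∈ A, ∃ q ∈ B, 0 < M.N p q r}

variable (M) in
/-- The set of charge conjugates of the elements of `A`. -/
def conjSet (A : Set P) : Set P := {q | ∃ p ∈ A, 0 < M.N p q M.vac}

section CenterFacts

lemma Lat.mem_cls {g : M.Lat} {p q : P} : q ∈ g.cls p ↔ ∀ α ∈ g, M.cc q α = M.cc p α := by
  simp only [Lat.cls, Set.mem_ofPred_eq, irrep_inj]

lemma mem_perp {X : Set P} {p : P} : p ∈ M.perp X ↔ ∀ α ∈ X, M.cc p α = 1 := by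
  change (∀ α ∈ X, M.irrep p α = M.irrep M.vac α) ↔ _
  simp only [irrep_inj, cc_vac]

lemma Lat.cls_vac (g : M.Lat) : g.cls M.vac = (g.dual : Set P) := rfl

/-- The kernel of the orthogonal projection belonging to `g`. -/
def Lat.K (g : M.Lat) (p q : P) : ℂ :=
  ∑ α, (g : Set P).indicator (fun α => M.S α p * conj (M.S α q)) α

lemma Lat.K_eq_zero (g : M.Lat) {p q : P} (h : q ∉ g.cls p) : g.K p q = 0 := by
  classical
  obtain ⟨β, hβ, hne⟩ : ∃ β ∈ g, M.irrep q β ≠ M.irrep p β := by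
    simpa [Lat.cls] using h
  obtain ⟨b, hb⟩ := exists_conj (M := M) β
  have hbg : b ∈ g := g.conj_mem hβ hb
  let G : Finset P := Finset.univ.filter (· ∈ g)
  have hG : ∀ {x}, x ∈ G ↔ x ∈ g := by simp [G]
  have hK : g.K p q = ∑ α ∈ G, M.S α p * conj (M.S α q) := by
    rw [Lat.K, Finset.sum_filter]
    refine Finset.sum_congr rfl fun α _ => ?_
    simp [Set.indicator_apply]
  have e1 : M.irrep p β * g.K p q
      = ∑ α ∈ G, ∑ γ ∈ G, (M.N β α γ : ℂ) * M.S γ p * conj (M.S α q) := by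
    rw [hK, Finset.mul_sum]
    refine Finset.sum_congr rfl fun α ha => ?_
    have h1 : M.irrep p β * (M.S α p * conj (M.S α q))
        = (M.S β p * M.S α p / M.v p) * conj (M.S α q) := by
      rw [irrep, S_vac]; ring
    rw [h1, ← fus, Finset.sum_mul]
    symm
    refine Finset.sum_subset (Finset.subset_univ _) fun γ _ hc => ?_
    have : M.N β α γ = 0 := by
      by_contra h
      exact hc (hG.2 (g.fusion_mem hβ (hG.1 ha) (Nat.pos_of_ne_zero h)))
    simp [this]
  have e2 : M.irrep q β * g.K p q
      = ∑ γ ∈ G, ∑ α ∈ G, (M.N β α γ : ℂ) * M.S γ p * conj (M.S α q) := by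
    rw [hK, Finset.mul_sum]
    refine Finset.sum_congr rfl fun γ hγ => ?_
    have h1 : M.irrep q β * (M.S γ p * conj (M.S γ q))
        = M.S γ p * conj (M.S b q * M.S γ q / M.v q) := by
      rw [irrep, S_vac, S_conj hb]; simp; ring
    rw [h1, ← fus, map_sum, Finset.mul_sum]
    symm
    rw [Finset.sum_subset (Finset.subset_univ G)]
    · refine Finset.sum_congr rfl fun α _ => ?_
      rw [N_conj hb]; simp; ring
    · intro α _ hc
      have : M.N β α γ = 0 := by
        by_contra h
        exact hc (hG.2 (g.div_mem hβ (hG.1 hγ) (Nat.pos_of_ne_zero h)))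
      simp [this]
  have e3 : (M.irrep q β - M.irrep p β) * g.K p q = 0 := by
    rw [sub_mul, e1, e2, Finset.sum_comm, sub_self]
  exact (mul_eq_zero.1 e3).resolve_left (sub_ne_zero.2 hne)

lemma Lat.K_eq (g : M.Lat) {p q : P} (h : q ∈ g.cls p) :
    g.K p q = g.K p p * (M.v q / M.v p) := by
  rw [Lat.K, Lat.K, Finset.sum_mul]
  refine Finset.sum_congr rfl fun α _ => ?_
  by_cases hα : α ∈ (g : Set P)
  · rw [Set.indicator_of_mem hα, Set.indicator_of_mem hα]
    have h1 : M.S α q = M.S α p * (M.v q / M.v p) := by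
      have := vC_ne (M := M) p
      rw [S_eq, Lat.mem_cls.1 h α hα, S_eq]; field_simp
    rw [h1]; simp; ring
  · rw [Set.indicator_of_notMem hα, Set.indicator_of_notMem hα, zero_mul]

lemma Lat.sum_K (g : M.Lat) (p r : P) :
    ∑ q, g.K p q * M.S r q = (g : Set P).indicator (fun r => M.S r p) r := by
  simp_rw [Lat.K, Finset.sum_mul]
  rw [Finset.sum_comm]
  have : ∀ α, ∑ q, (g : Set P).indicator (fun α => M.S α p * conj (M.S α q)) α * M.S r q
      = (g : Set P).indicator (fun α => M.S α p) α * (if r = α then 1 else 0) := by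
    intro α
    rw [← orth (M := M) r α, Finset.mul_sum]
    refine Finset.sum_congr rfl fun q _ => ?_
    by_cases hα : α ∈ (g : Set P)
    · rw [Set.indicator_of_mem hα, Set.indicator_of_mem hα]; ring
    · rw [Set.indicator_of_notMem hα, Set.indicator_of_notMem hα]; ring
  simp_rw [this]
  simp

/-- The duality map is involutive. -/
lemma Lat.dual_dual (g : M.Lat) : g.dual.dual = g := by
  refine le_antisymm (fun α hα => ?_) (fun α hα => ?_)
  · by_contra hg
    have h1 := g.sum_K M.vac α
    rw [Set.indicator_of_notMem (show α ∉ (g : Set P) from hg)] at h1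
    have h2 : ∀ q, g.K M.vac q * M.S α q = ((g.K M.vac M.vac).re *
        ((g.dual : Set P).indicator (fun q => M.v q * M.v q * M.v α) q
          / (M.v M.vac * M.v M.vac)) : ℝ) := by
      intro q
      have hre : ((g.K M.vac M.vac).re : ℂ) = g.K M.vac M.vac := by
        refine Complex.ext rfl ?_
        rw [Lat.K, Complex.im_sum]
        refine (Finset.sum_eq_zero fun a _ => ?_).symm
        by_cases ha : a ∈ (g : Set P)
        · rw [Set.indicator_of_mem ha, Complex.mul_conj]; simp
        · rw [Set.indicator_of_notMem ha]; simp
      by_cases hq : q ∈ (g.dual : Set P)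
      · rw [Set.indicator_of_mem hq, g.K_eq (by rw [g.cls_vac]; exact hq), S_eq, cc_comm,
          mem_perp.1 hα q hq]
        push_cast
        rw [hre]; ring
      · rw [Set.indicator_of_notMem hq, g.K_eq_zero (by rw [g.cls_vac]; exact hq)]
        simp
    simp_rw [h2] at h1
    have h3 : ∑ q, (g.K M.vac M.vac).re *
        ((g.dual : Set P).indicator (fun q => M.v q * M.v q * M.v α) q
          / (M.v M.vac * M.v M.vac)) = 0 := by exact_mod_cast h1
    have hK : 0 < (g.K M.vac M.vac).re := by
      rw [Lat.K, Complex.re_sum]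
      refine Finset.sum_pos' (fun a _ => ?_) ⟨M.vac, Finset.mem_univ _, ?_⟩
      · by_cases ha : a ∈ (g : Set P)
        · rw [Set.indicator_of_mem ha, Complex.mul_conj, Complex.ofReal_re]
          exact Complex.normSq_nonneg _
        · rw [Set.indicator_of_notMem ha]; simp
      · rw [Set.indicator_of_mem (show M.vac ∈ (g : Set P) from g.vac_mem), Complex.mul_conj,
          Complex.ofReal_re, S_vac]
        exact Complex.normSq_pos.2 (vC_ne _)
    have h4 : 0 < ∑ q, (g.K M.vac M.vac).re *
        ((g.dual : Set P).indicator (fun q => M.v q * M.v q * M.v α) q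
          / (M.v M.vac * M.v M.vac)) := by
      have hv := fun q => v_pos (M := M) q
      have hv0 := hv M.vac
      have hva := hv α
      refine Finset.sum_pos' (fun q _ => ?_) ⟨M.vac, Finset.mem_univ _, ?_⟩
      · refine mul_nonneg hK.le (div_nonneg (Set.indicator_nonneg (fun q _ => ?_) q) ?_)
        · have := hv q
          positivity
        · positivity
      · rw [Set.indicator_of_mem (show M.vac ∈ (g.dual : Set P) from g.dual.vac_mem)]
        positivity
    exact h4.ne' h3
  · exact mem_perp.2 fun q hq => by rw [cc_comm]; exact mem_perp.1 hq α hα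

/-- The mass of a class determines the norm of its restricted character. -/
lemma Lat.mass_mul (g : M.Lat) (p : P) :
    (M.mass (g.cls p)) * ∑ α, (g : Set P).indicator (fun α => ‖M.cc p α‖ ^ 2 * M.v α ^ 2) α
      = 1 := by
  have hvp := (v_pos (M := M) p).ne'
  have hv0 := (v_pos (M := M) M.vac).ne'
  have hK : g.K p p = ((M.v p ^ 2 / M.v M.vac ^ 2 *
      ∑ α, (g : Set P).indicator (fun α => ‖M.cc p α‖ ^ 2 * M.v α ^ 2) α : ℝ) : ℂ) := by
    rw [Lat.K, Complex.ofReal_mul, Complex.ofReal_sum, Finset.mul_sum]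
    refine Finset.sum_congr rfl fun α _ => ?_
    by_cases hα : α ∈ (g : Set P)
    · rw [Set.indicator_of_mem hα, Set.indicator_of_mem hα, S_eq]
      have : (M.cc p α * (M.v α * M.v p) / M.v M.vac)
          * conj (M.cc p α * (M.v α * M.v p) / M.v M.vac : ℂ)
          = (M.cc p α * conj (M.cc p α)) * (M.v α * M.v p / M.v M.vac) ^ 2 := by
        simp; ring
      rw [this, Complex.mul_conj, Complex.normSq_eq_norm_sq]
      push_cast; ring
    · rw [Set.indicator_of_notMem hα, Set.indicator_of_notMem hα]; simp
  have h1 := g.sum_K p M.vac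
  rw [Set.indicator_of_mem (show M.vac ∈ (g : Set P) from g.vac_mem)] at h1
  have h2 : ∀ q, g.K p q * M.S M.vac q
      = g.K p p * (((g.cls p).indicator (fun q => M.qdim q ^ 2) q * M.v M.vac ^ 2 / M.v p : ℝ) : ℂ)
      := by
    intro q
    by_cases hq : q ∈ g.cls p
    · rw [Set.indicator_of_mem hq, g.K_eq hq, S_vac]
      have : M.qdim q ^ 2 * M.v M.vac ^ 2 = M.v q ^ 2 := by
        change (M.v q / M.v M.vac) ^ 2 * _ = _
        field_simp
      rw [this]; push_cast; ring
    · rw [Set.indicator_of_notMem hq, g.K_eq_zero hq]; simp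
  simp_rw [h2] at h1
  rw [← Finset.mul_sum, hK, S_vac, ← Complex.ofReal_sum, ← Complex.ofReal_mul,
    Complex.ofReal_inj, ← Finset.sum_div, ← Finset.sum_mul] at h1
  change _ * (M.mass (g.cls p) * _ / _) = _ at h1
  field_simp at h1
  linarith

/-- A `g`-class is central iff the normalized characters of its elements are unimodular on `g`. -/
lemma Lat.isCentral_iff (g : M.Lat) (p : P) :
    g.IsCentral (g.cls p) ↔ ∀ α ∈ g, ‖M.cc p α‖ = 1 := by
  set f : P → P → ℝ := fun p α => (g : Set P).indicator (fun α => ‖M.cc p α‖ ^ 2 * M.v α ^ 2) α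
    with hf
  have hle : ∀ q α, f q α ≤ f M.vac α := by
    intro q α
    by_cases hα : α ∈ (g : Set P)
    · simp only [hf]
      rw [Set.indicator_of_mem hα, Set.indicator_of_mem hα, cc_vac, norm_one]
      have := cc_norm_le (M := M) q α
      exact mul_le_mul_of_nonneg_right (by
        rw [one_pow]; exact pow_le_one₀ (norm_nonneg _) this) (sq_nonneg _)
    · simp only [hf]
      rw [Set.indicator_of_notMem hα, Set.indicator_of_notMem hα]
  have hm : ∀ q, M.mass (g.cls q) * ∑ α, f q α = 1 := fun q => g.mass_mul q
  have hf0 : ∀ q, 0 ≤ ∑ α, f q α := fun q => Finset.sum_nonneg fun α _ => by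
    simp only [hf]
    exact Set.indicator_nonneg (fun α _ => by positivity) α
  have hfp : ∀ q, 0 < ∑ α, f q α := fun q => lt_of_le_of_ne (hf0 q) fun h => by
    have := hm q
    rw [← h] at this; simp at this
  have hmass : ∀ q, M.mass (g.cls q) = (∑ α, f q α)⁻¹ := fun q =>
    eq_inv_of_mul_eq_one_left (hm q)
  constructor
  · rintro ⟨-, h⟩ α hα
    have h1 := h M.vac
    rw [hmass, hmass, inv_le_inv₀ (hfp _) (hfp _)] at h1
    have h2 : ∑ α, f p α = ∑ α, f M.vac α :=
      le_antisymm (Finset.sum_le_sum fun α _ => hle p α) h1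
    have h3 := (Finset.sum_eq_sum_iff_of_le fun α _ => hle p α).1 h2 α (Finset.mem_univ _)
    simp only [hf] at h3
    rw [Set.indicator_of_mem (show α ∈ (g : Set P) from hα),
      Set.indicator_of_mem (show α ∈ (g : Set P) from hα), cc_vac, norm_one, one_pow] at h3
    have h4 := mul_right_cancel₀ (pow_ne_zero 2 (v_pos (M := M) α).ne') h3
    exact (pow_eq_one_iff_of_nonneg (norm_nonneg _) two_ne_zero).1 h4
  · intro h
    refine ⟨⟨p, rfl⟩, fun q => ?_⟩
    rw [hmass, hmass, inv_le_inv₀ (hfp _) (hfp _)]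
    refine Finset.sum_le_sum fun α _ => (hle q α).trans (le_of_eq ?_)
    by_cases hα : α ∈ (g : Set P)
    · simp only [hf]
      rw [Set.indicator_of_mem hα, Set.indicator_of_mem hα, cc_vac, norm_one, h α hα]
    · simp only [hf]
      rw [Set.indicator_of_notMem hα, Set.indicator_of_notMem hα]

lemma Lat.cls_eq_of_mem {g : M.Lat} {p q : P} (h : q ∈ g.cls p) : g.cls q = g.cls p := by
  ext r
  rw [Lat.mem_cls] at h
  rw [Lat.mem_cls, Lat.mem_cls]
  exact forall₂_congr fun α hα => by rw [h α hα]

lemma Lat.IsCentral.norm_cc {g : M.Lat} {z : Set P} (hz : g.IsCentral z) {p : P} (hp : p ∈ z) :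
    ∀ α ∈ g, ‖M.cc p α‖ = 1 := by
  obtain ⟨q, rfl⟩ := hz.1
  rw [← Lat.cls_eq_of_mem hp] at hz
  exact (g.isCentral_iff p).1 hz

lemma Lat.IsCentral.eq_cls {g : M.Lat} {z : Set P} (hz : g.IsCentral z) {p : P} (hp : p ∈ z) :
    z = g.cls p := by
  obtain ⟨q, rfl⟩ := hz.1
  exact (Lat.cls_eq_of_mem hp).symm

lemma Lat.IsCentral.nonempty {g : M.Lat} {z : Set P} (hz : g.IsCentral z) : ∃ p, p ∈ z := by
  obtain ⟨q, rfl⟩ := hz.1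
  exact ⟨q, fun _ _ => rfl⟩

lemma fuse_cls {g : M.Lat} {z w : Set P} (hz : g.IsCentral z) (hw : g.IsCentral w) {p q r : P}
    (hp : p ∈ z) (hq : q ∈ w) (hr : 0 < M.N p q r) : M.fuse z w = g.cls r := by
  have hcr : ∀ α ∈ g, M.cc r α = M.cc p α * M.cc q α := fun α hα =>
    cc_fusion (hz.norm_cc hp α hα) (hw.norm_cc hq α hα) hr
  ext t
  constructor
  · rintro ⟨p', hp', q', hq', ht⟩
    rw [Lat.mem_cls]
    intro α hα
    rw [hz.eq_cls hp] at hp'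
    rw [hw.eq_cls hq] at hq'
    have h1 := Lat.mem_cls.1 hp' α hα
    have h2 := Lat.mem_cls.1 hq' α hα
    have h3 := hz.norm_cc hp α hα
    have h4 := hw.norm_cc hq α hα
    rw [cc_fusion (by rw [h1, h3]) (by rw [h2, h4]) ht, h1, h2, hcr α hα]
  · intro ht
    obtain ⟨b, hb⟩ := exists_conj (M := M) p
    obtain ⟨s, hs⟩ := exists_fusion (M := M) b t
    refine ⟨p, hp, s, ?_, ?_⟩
    · rw [hw.eq_cls hq, Lat.mem_cls]
      intro α hα
      have h1 := Lat.mem_cls.1 ht α hα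
      have h3 := hz.norm_cc hp α hα
      have h4 := hw.norm_cc hq α hα
      rw [cc_fusion (p := b) (q := t) (by rw [cc_conj hb, RCLike.norm_conj, h3])
        (by rw [h1, hcr α hα, norm_mul, h3, h4, one_mul]) hs, h1, hcr α hα, cc_conj hb, ← mul_assoc,
        mul_comm (conj _), Complex.mul_conj, Complex.normSq_eq_norm_sq, h3]
      simp
    · rwa [N_conj hb] at hs

lemma Lat.IsCentral.fuse {g : M.Lat} {z w : Set P} (hz : g.IsCentral z) (hw : g.IsCentral w) :
    g.IsCentral (M.fuse z w) := by
  obtain ⟨p, hp⟩ := hz.nonempty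
  obtain ⟨q, hq⟩ := hw.nonempty
  obtain ⟨r, hr⟩ := exists_fusion (M := M) p q
  rw [fuse_cls hz hw hp hq hr, Lat.isCentral_iff]
  intro α hα
  rw [cc_fusion (hz.norm_cc hp α hα) (hw.norm_cc hq α hα) hr, norm_mul, hz.norm_cc hp α hα,
    hw.norm_cc hq α hα, one_mul]

lemma Lat.isCentral_dual (g : M.Lat) : g.IsCentral (g.dual : Set P) := by
  rw [← g.cls_vac, g.isCentral_iff]
  intro α _
  rw [cc_vac, norm_one]

lemma Lat.IsCentral.conjSet {g : M.Lat} {z : Set P} (hz : g.IsCentral z) :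
    g.IsCentral (M.conjSet z) := by
  obtain ⟨p, hp⟩ := hz.nonempty
  obtain ⟨b, hb⟩ := exists_conj (M := M) p
  have h : M.conjSet z = g.cls b := by
    ext t
    constructor
    · rintro ⟨q, hq, ht⟩
      rw [hz.eq_cls hp] at hq
      rw [Lat.mem_cls]
      intro α hα
      rw [cc_conj ht, cc_conj hb, Lat.mem_cls.1 hq α hα]
    · intro ht
      obtain ⟨s, hs⟩ := exists_conj (M := M) t
      refine ⟨s, ?_, by rwa [N_comm]⟩
      rw [hz.eq_cls hp, Lat.mem_cls]
      intro α hα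
      rw [cc_conj hs, Lat.mem_cls.1 ht α hα, cc_conj hb, Complex.conj_conj]
  rw [h, Lat.isCentral_iff]
  intro α hα
  rw [cc_conj hb, RCLike.norm_conj, hz.norm_cc hp α hα]

/-- For `h ⊆ g`, a central `g`-class is contained in a unique central `h`-class. -/
lemma Lat.IsCentral.restrict {g h : M.Lat} (hle : h ≤ g) {z : Set P} (hz : g.IsCentral z) :
    ∃! w : Set P, h.IsCentral w ∧ z ⊆ w := by
  obtain ⟨p, hp⟩ := hz.nonempty
  refine ⟨h.cls p, ⟨?_, ?_⟩, ?_⟩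
  · rw [Lat.isCentral_iff]
    exact fun α hα => hz.norm_cc hp α (hle hα)
  · intro q hq
    rw [hz.eq_cls hp, Lat.mem_cls] at hq
    exact Lat.mem_cls.2 fun α hα => hq α (hle hα)
  · rintro w ⟨hw, hzw⟩
    exact hw.eq_cls (hzw hp)

end CenterFacts

/-- The center is an abelian group under the fusion product of central classes; the identity is the
trivial class, inversion is charge conjugation. -/
instance (g : M.Lat) : CommGroup g.Center where
  mul z w := ⟨M.fuse z.1 w.1, z.2.fuse w.2⟩
  one := ⟨(g.dual : Set P), g.isCentral_dual⟩
  inv z := ⟨M.conjSet z.1, z.2.conjSet⟩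
  mul_comm z w := Subtype.ext <| Set.ext fun r =>
    ⟨fun ⟨p, hp, q, hq, h⟩ => ⟨q, hq, p, hp, by rwa [N_comm]⟩,
      fun ⟨p, hp, q, hq, h⟩ => ⟨q, hq, p, hp, by rwa [N_comm]⟩⟩
  mul_assoc x y z := by
    apply Subtype.ext
    change M.fuse (M.fuse x.1 y.1) z.1 = M.fuse x.1 (M.fuse y.1 z.1)
    obtain ⟨p, hp⟩ := x.2.nonempty
    obtain ⟨q, hq⟩ := y.2.nonempty
    obtain ⟨r, hr⟩ := z.2.nonempty
    obtain ⟨s, hs⟩ := exists_fusion (M := M) p q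
    obtain ⟨t, ht⟩ := exists_fusion (M := M) q r
    obtain ⟨a, ha⟩ := exists_fusion (M := M) s r
    obtain ⟨b, hb⟩ := exists_fusion (M := M) p t
    have hs' : s ∈ M.fuse x.1 y.1 := ⟨p, hp, q, hq, hs⟩
    have ht' : t ∈ M.fuse y.1 z.1 := ⟨q, hq, r, hr, ht⟩
    rw [fuse_cls (x.2.fuse y.2) z.2 hs' hr ha, fuse_cls x.2 (y.2.fuse z.2) hp ht' hb]
    refine Lat.cls_eq_of_mem (Lat.mem_cls.2 fun α hα => ?_)
    rw [cc_fusion ((x.2.fuse y.2).norm_cc hs' α hα) (z.2.norm_cc hr α hα) ha,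
      cc_fusion (x.2.norm_cc hp α hα) ((y.2.fuse z.2).norm_cc ht' α hα) hb,
      cc_fusion (x.2.norm_cc hp α hα) (y.2.norm_cc hq α hα) hs,
      cc_fusion (y.2.norm_cc hq α hα) (z.2.norm_cc hr α hα) ht, mul_assoc]
  one_mul z := by
    apply Subtype.ext
    change M.fuse (g.dual : Set P) z.1 = z.1
    obtain ⟨p, hp⟩ := z.2.nonempty
    rw [fuse_cls g.isCentral_dual z.2 (show M.vac ∈ (g.dual : Set P) from g.dual.vac_mem) hp
      (by rw [N_vac]; exact one_pos), ← z.2.eq_cls hp]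
  mul_one z := by
    apply Subtype.ext
    change M.fuse z.1 (g.dual : Set P) = z.1
    obtain ⟨p, hp⟩ := z.2.nonempty
    rw [fuse_cls z.2 g.isCentral_dual hp (show M.vac ∈ (g.dual : Set P) from g.dual.vac_mem)
      (by rw [N_comm, N_vac]; exact one_pos), ← z.2.eq_cls hp]
  inv_mul_cancel z := by
    apply Subtype.ext
    change M.fuse (M.conjSet z.1) z.1 = (g.dual : Set P)
    obtain ⟨p, hp⟩ := z.2.nonempty
    obtain ⟨b, hb⟩ := exists_conj (M := M) p
    have hb' : b ∈ M.conjSet z.1 := ⟨p, hp, hb⟩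
    rw [fuse_cls z.2.conjSet z.2 hb' hp (r := M.vac) (by rwa [N_comm]), g.cls_vac]

/-- The restriction homomorphism `Z(g) → Z(h)` for `h ⊆ g`, assigning to a central `g`-class the
unique central `h`-class that contains it. -/
def restrict {g h : M.Lat} (hle : h ≤ g) : g.Center →* h.Center :=
  MonoidHom.mk' (fun z => ⟨(z.2.restrict hle).choose, (z.2.restrict hle).choose_spec.1.1⟩) (by
    intro z w
    apply Subtype.ext
    refine (((z * w).2.restrict hle).choose_spec.2 _ ⟨?_, ?_⟩).symm
    · exact (z.2.restrict hle).choose_spec.1.1.fuse (w.2.restrict hle).choose_spec.1.1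
    · rintro r ⟨p, hp, q, hq, hr⟩
      exact ⟨p, (z.2.restrict hle).choose_spec.1.2 hp, q,
        (w.2.restrict hle).choose_spec.1.2 hq, hr⟩)

/-- `Z(g|h)`: the kernel of the restriction homomorphism `Z(g) → Z(h)`. -/
def ZR {g h : M.Lat} (hle : h ≤ g) : Subgroup g.Center := (restrict hle).ker

/-- `I(g|h)`: the image of the restriction homomorphism `Z(g) → Z(h)`. -/
def IR {g h : M.Lat} (hle : h ≤ g) : Subgroup h.Center := (restrict hle).range

/-- `Z(g|h)` consists of the central `g`-classes contained in the trivial class `h^⊥`. -/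
lemma mem_ZR {g h : M.Lat} (hle : h ≤ g) (z : g.Center) :
    z ∈ ZR hle ↔ z.1 ⊆ (h.dual : Set P) := by
  have hs := (z.2.restrict hle).choose_spec
  rw [ZR, MonoidHom.mem_ker]
  constructor
  · intro hz
    have : (z.2.restrict hle).choose = (h.dual : Set P) := congrArg Subtype.val hz
    rw [← this]
    exact hs.1.2
  · intro hz
    exact Subtype.ext (hs.2 _ ⟨h.isCentral_dual, hz⟩).symm

/-- The central quotient `g/H` for a subgroup `H` of the center: the element of the lattice whose
trivial class `(g/H)^⊥` is the union of the classes in `H`. -/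
def quot (g : M.Lat) (H : Subgroup g.Center) : M.Lat := M.perp (⋃ z ∈ H, z.1)

/-- The defining property of `g/H`. -/
lemma quot_dual (g : M.Lat) (H : Subgroup g.Center) :
    ((quot g H).dual : Set P) = ⋃ z ∈ H, z.1 := by
  let U : M.Lat :=
    { carrier := ⋃ z ∈ H, z.1
      vac_mem := Set.mem_iUnion₂.2 ⟨1, H.one_mem, g.dual.vac_mem⟩
      fusion_mem := by
        intro p q r hp hq hN
        obtain ⟨z, hz, hpz⟩ := Set.mem_iUnion₂.1 hp
        obtain ⟨w, hw, hqw⟩ := Set.mem_iUnion₂.1 hq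
        exact Set.mem_iUnion₂.2 ⟨z * w, H.mul_mem hz hw, p, hpz, q, hqw, hN⟩ }
  change (U.dual.dual : Set P) = U
  rw [U.dual_dual]

/-- `h` is a central quotient of `g`. -/
def IsCentralQuotient (h g : M.Lat) : Prop := ∃ H : Subgroup g.Center, h = quot g H

lemma quot_le (g : M.Lat) (H : Subgroup g.Center) : quot g H ≤ g := by
  intro α hα
  rw [← g.dual_dual]
  refine mem_perp.2 fun p hp => mem_perp.1 hα p ?_
  exact Set.mem_iUnion₂.2 ⟨1, H.one_mem, hp⟩

lemma IsCentralQuotient.le {h g : M.Lat} (hc : IsCentralQuotient h g) : h ≤ g := by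
  obtain ⟨H, rfl⟩ := hc
  exact quot_le g H

/-- The maximal central quotient `∂g = g/Z(g)`. -/
def maxQuot (g : M.Lat) : M.Lat := quot g ⊤

end ConformalModel

end

namespace ConformalModel

variable {P : Type*} [Fintype P] [DecidableEq P] {M : ConformalModel P}

/-! Duality is an order-reversing involution of the lattice, so inclusions may be tested on trivial
classes. There `(quot g H)^⊥` is the union of the classes in `H`, while `Z(g|j)` consists of the
central `g`-classes inside `j^⊥`. Hence, for `j ≤ g`, `j ≤ quot g H ↔ H ≤ Z(g|j)`: an antitone
Galois connection (`le_quot_iff`).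

Everything rests on identifying its closed elements. Every subgroup is closed, because distinct
classes are disjoint (`ZR_quot`). A lattice element `j ≤ g` is closed as soon as it lies above `∂g`
(`quot_ZR`): `j^⊥` is a union of `g`-classes, and it sits in `(∂g)^⊥`, the union of all central
classes. Thus the interval `[∂g, g]` is anti-isomorphic to the lattice of subgroups of `Z(g)`. The
join and meet formulas, the product formula for kernels and the isomorphism above a central quotient
`h` follow formally.

The interval `[∂g, h]` is handled by the same correspondence with `h` in place of `g`, since `∂h ≤
∂g ≤ h`. What remains is `I(g|h) = Z(h|∂g)` (`IR_eq_ZR`), the one place where fusion products enter.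
-/

/-! ### Trivial classes and duality -/

lemma Lat.dual_anti {g h : M.Lat} (hle : g ≤ h) : h.dual ≤ g.dual := fun _ hp =>
  mem_perp.2 fun α hα => mem_perp.1 hp α (hle hα)

lemma Lat.dual_le_dual {g h : M.Lat} : h.dual ≤ g.dual ↔ g ≤ h :=
  ⟨fun hle => by simpa only [Lat.dual_dual] using Lat.dual_anti hle, Lat.dual_anti⟩

lemma mem_quot_dual {g : M.Lat} {H : Subgroup g.Center} {p : P} :
    p ∈ (quot g H).dual ↔ ∃ z ∈ H, p ∈ z.1 := by
  change p ∈ ((quot g H).dual : Set P) ↔ _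
  rw [quot_dual]
  simp only [Set.mem_iUnion, exists_prop]

/-- The trivial class of the maximal central quotient consists of the primaries whose normalized
characters are unimodular on `g`. -/
lemma mem_maxQuot_dual {g : M.Lat} {p : P} :
    p ∈ (maxQuot g).dual ↔ ∀ α ∈ g, ‖M.cc p α‖ = 1 := by
  rw [maxQuot, mem_quot_dual]
  exact ⟨fun ⟨z, _, hp⟩ => z.2.norm_cc hp,
    fun h => ⟨⟨g.cls p, (g.isCentral_iff p).2 h⟩, Subgroup.mem_top _, fun _ _ => rfl⟩⟩

/-! ### The Galois connection and its closed elements -/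

/-- The Galois connection between subgroups of the center and the lattice elements below `g`. -/
lemma le_quot_iff {g j : M.Lat} (hle : j ≤ g) (H : Subgroup g.Center) :
    j ≤ quot g H ↔ H ≤ ZR hle := by
  rw [← Lat.dual_le_dual]
  exact ⟨fun h z hz => (mem_ZR hle z).2 fun p hp => h (mem_quot_dual.2 ⟨z, hz, hp⟩),
    fun h p hp => by
      obtain ⟨z, hz, hpz⟩ := mem_quot_dual.1 hp
      exact (mem_ZR hle z).1 (h hz) hpz⟩

/-- Every subgroup is closed: a central class inside the union of the classes in `H` meets one of
them, and two classes with a common element coincide. -/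
lemma ZR_quot (g : M.Lat) (H : Subgroup g.Center) : ZR (quot_le g H) = H := by
  refine le_antisymm (fun z hz => ?_) ((le_quot_iff _ _).1 le_rfl)
  obtain ⟨p, hp⟩ := z.2.nonempty
  obtain ⟨w, hw, hpw⟩ := mem_quot_dual.1 ((mem_ZR _ z).1 hz hp)
  rwa [show z = w from Subtype.ext ((z.2.eq_cls hp).trans (w.2.eq_cls hpw).symm)]

/-- Lying above `∂g` is what makes `j` closed: it forces each `p ∈ j^⊥` to be unimodular on `g`, so
that the `g`-class of `p` is central. As `j ≤ g`, that whole class stays in `j^⊥`, hence belongs to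
`Z(g|j)`. -/
lemma quot_ZR {g j : M.Lat} (hmax : maxQuot g ≤ j) (hle : j ≤ g) : quot g (ZR hle) = j := by
  refine le_antisymm (Lat.dual_le_dual.1 fun p hp => ?_) ((le_quot_iff _ _).2 le_rfl)
  have hc := mem_maxQuot_dual.1 (Lat.dual_anti hmax hp)
  refine mem_quot_dual.2 ⟨⟨g.cls p, (g.isCentral_iff p).2 hc⟩, ?_, fun _ _ => rfl⟩
  refine (mem_ZR hle _).2 fun q hq => mem_perp.2 fun α hα => ?_
  rw [Lat.mem_cls.1 hq α (hle hα), mem_perp.1 hp α hα]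

lemma quot_anti {g : M.Lat} {H K : Subgroup g.Center} (hHK : H ≤ K) : quot g K ≤ quot g H := by
  rwa [le_quot_iff (quot_le g K), ZR_quot]

lemma ZR_anti {g j k : M.Lat} (hjk : j ≤ k) (hk : k ≤ g) : ZR hk ≤ ZR (hjk.trans hk) :=
  (le_quot_iff _ _).1 (hjk.trans ((le_quot_iff hk _).2 le_rfl))

lemma maxQuot_le_quot (g : M.Lat) (H : Subgroup g.Center) : maxQuot g ≤ quot g H :=
  quot_anti le_top

lemma IsCentralQuotient.maxQuot_le {g h : M.Lat} (hc : IsCentralQuotient h g) :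
    maxQuot g ≤ h := by
  obtain ⟨H, rfl⟩ := hc
  exact maxQuot_le_quot g H

/-- Unimodularity on `g` restricts to unimodularity on the smaller `h`. This makes the
correspondence for `h` available on the interval above `∂g`. -/
lemma maxQuot_mono {g h : M.Lat} (hle : h ≤ g) : maxQuot h ≤ maxQuot g :=
  Lat.dual_le_dual.1 fun _ hp =>
    mem_maxQuot_dual.2 fun α hα => mem_maxQuot_dual.1 hp α (hle hα)

/-! ### Joins, meets and products of kernels -/

lemma quot_sup_quot (g : M.Lat) (H K : Subgroup g.Center) :
    quot g H ⊔ quot g K = quot g (H ⊓ K) := by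
  have hle : quot g H ⊔ quot g K ≤ g := sup_le (quot_le g H) (quot_le g K)
  refine le_antisymm (sup_le (quot_anti inf_le_left) (quot_anti inf_le_right)) ?_
  -- The join lies between `∂g` and `g`, so it is itself a central quotient, by its own kernel. It
  -- then suffices to bound that kernel by `H` and by `K`.
  rw [← quot_ZR ((maxQuot_le_quot g H).trans le_sup_left) hle]
  refine quot_anti (le_inf ?_ ?_)
  · exact (ZR_anti le_sup_left hle).trans (ZR_quot g H).le
  · exact (ZR_anti le_sup_right hle).trans (ZR_quot g K).le

/-- An antitone Galois connection turns joins of subgroups into meets, so here, unlike for the join,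
closedness of the lattice element is not needed. -/
lemma quot_inf_quot (g : M.Lat) (H K : Subgroup g.Center) :
    quot g H ⊓ quot g K = quot g (H ⊔ K) := by
  refine le_antisymm ?_ (le_inf (quot_anti le_sup_left) (quot_anti le_sup_right))
  rw [le_quot_iff (inf_le_left.trans (quot_le g H))]
  exact sup_le ((le_quot_iff _ _).1 inf_le_left) ((le_quot_iff _ _).1 inf_le_right)

lemma ZR_mul_ZR {g h₁ h₂ : M.Lat} (hc₁ : IsCentralQuotient h₁ g) (hc₂ : IsCentralQuotient h₂ g) :
    (ZR hc₁.le : Set g.Center) * (ZR hc₂.le : Set g.Center)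
      = (ZR (inf_le_left.trans hc₁.le : h₁ ⊓ h₂ ≤ g) : Set g.Center) := by
  obtain ⟨H, rfl⟩ := hc₁
  obtain ⟨K, rfl⟩ := hc₂
  have hinf : ZR (inf_le_left.trans (quot_le g H) : quot g H ⊓ quot g K ≤ g) = H ⊔ K := by
    -- The type of `ZR hj` depends on the proof that `j ≤ g`, so the lattice element is generalized
    -- to a variable before the meet formula is substituted.
    have key : ∀ {j : M.Lat} (hj : j ≤ g), j = quot g (H ⊔ K) → ZR hj = H ⊔ K := by
      rintro _ _ rfl
      exact ZR_quot g _
    exact key _ (quot_inf_quot g H K)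
  -- The center is abelian, so its subgroups are normal and the pointwise product of two of them is
  -- their join.
  rw [hinf, ZR_quot, ZR_quot, Subgroup.mul_normal]

/-! ### Interval isomorphisms and the image of restriction -/

/-- The Galois correspondence between the interval `[k, g]` above a central quotient `k` of `g` and
the subgroups of `Z(g|k)`. -/
def galoisIso {g k : M.Lat} (hmax : maxQuot g ≤ k) (hle : k ≤ g) :
    Set.Icc k g ≃o (Set.Iic (ZR hle))ᵒᵈ where
  toFun j := OrderDual.toDual ⟨ZR j.2.2, ZR_anti j.2.1 j.2.2⟩
  invFun H := ⟨quot g (OrderDual.ofDual H).1,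
    (le_quot_iff hle _).2 (OrderDual.ofDual H).2, quot_le g _⟩
  left_inv j := Subtype.ext (quot_ZR (hmax.trans j.2.1) j.2.2)
  right_inv H := Subtype.ext (ZR_quot g (OrderDual.ofDual H).1)
  map_rel_iff' {i j} := by
    change ZR j.2.2 ≤ ZR i.2.2 ↔ i.1 ≤ j.1
    -- The Galois connection taken at the subgroup `Z(g|j)`, whose quotient is `j` again by
    -- closedness.
    rw [← le_quot_iff, quot_ZR (hmax.trans j.2.1)]

/-- The image of `Z(g) → Z(h)` consists of the central `h`-classes that are trivial on `∂g`. -/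
lemma IR_eq_ZR {g h : M.Lat} (hc : IsCentralQuotient h g) : IR hc.le = ZR hc.maxQuot_le := by
  -- Uniqueness of the central `h`-class containing `w`.
  have restrict_eq : ∀ (w : g.Center) (z : h.Center), w.1 ⊆ z.1 → restrict hc.le w = z :=
    fun w z hwz => Subtype.ext ((w.2.restrict hc.le).choose_spec.2 _ ⟨z.2, hwz⟩).symm
  ext z
  rw [mem_ZR]
  constructor
  · rintro ⟨w, rfl⟩ p hp
    have hsub : w.1 ⊆ (restrict hc.le w).1 := (w.2.restrict hc.le).choose_spec.1.2
    set z := restrict hc.le w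
    -- An arbitrary `p ∈ z` is compared with `q ∈ w ⊆ z` through a constituent `r` of `q̄ × p`. On
    -- `h` the characters of `p` and `q` agree and are unimodular, so that of `r` is `|M.cc q α|² =
    -- 1` and `r ∈ h^⊥`.
    obtain ⟨q, hq⟩ := w.2.nonempty
    obtain ⟨b, hb⟩ := exists_conj (M := M) q
    obtain ⟨r, hr⟩ := exists_fusion (M := M) b p
    have hrh : r ∈ h.dual := mem_perp.2 fun α hα => by
      have hnq := z.2.norm_cc (hsub hq) α hα
      have hpq : M.cc p α = M.cc q α := by
        have := hp
        rw [z.2.eq_cls (hsub hq)] at this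
        exact Lat.mem_cls.1 this α hα
      rw [cc_fusion (by rw [cc_conj hb, RCLike.norm_conj, hnq]) (by rw [hpq, hnq]) hr,
        cc_conj hb, hpq, mul_comm, Complex.mul_conj, Complex.normSq_eq_norm_sq, hnq]
      simp
    -- This is where `h` being a central quotient matters: `h^⊥ ⊆ (∂g)^⊥` makes `r` unimodular on
    -- all of `g`.
    have hrn := mem_maxQuot_dual.1 (Lat.dual_anti hc.maxQuot_le hrh)
    -- Frobenius reciprocity puts `p` into `q × r`, a product of two primaries unimodular on `g`.
    rw [N_conj hb] at hr
    refine mem_maxQuot_dual.2 fun α hα => ?_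
    rw [cc_fusion (w.2.norm_cc hq α hα) (hrn α hα) hr, norm_mul, w.2.norm_cc hq α hα, hrn α hα,
      one_mul]
  · intro hz
    obtain ⟨p, hp⟩ := z.2.nonempty
    -- The preimage of `z` is the `g`-class of any `p ∈ z`: it is central since `p ∈ (∂g)^⊥`, and it
    -- lies in `z` since agreement on `g` implies agreement on `h`.
    refine ⟨⟨g.cls p, (g.isCentral_iff p).2 (mem_maxQuot_dual.1 (hz hp))⟩,
      restrict_eq _ _ fun q hq => ?_⟩
    rw [z.2.eq_cls hp]
    exact Lat.mem_cls.2 fun α hα => Lat.mem_cls.1 hq α (hc.le hα)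

end ConformalModel

open ConformalModel in
theorem mainTheorem6 {P : Type*} [Fintype P] [DecidableEq P] (M : ConformalModel P) (g : M.Lat) :
    (∀ (h₁ h₂ : M.Lat) (hc₁ : IsCentralQuotient h₁ g) (hc₂ : IsCentralQuotient h₂ g),
      (ZR hc₁.le : Set g.Center) * (ZR hc₂.le : Set g.Center)
        = (ZR (inf_le_left.trans hc₁.le : h₁ ⊓ h₂ ≤ g) : Set g.Center)) ∧
    (∀ H₁ H₂ : Subgroup g.Center,
      quot g H₁ ⊔ quot g H₂ = quot g (H₁ ⊓ H₂) ∧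
      quot g H₁ ⊓ quot g H₂ = quot g (H₁ ⊔ H₂)) ∧
    (∀ (h : M.Lat) (hc : IsCentralQuotient h g),
      (∃ e : Set.Icc h g ≃o (Set.Iic (ZR hc.le))ᵒᵈ,
        (∀ j : Set.Icc h g, (OrderDual.ofDual (e j)).1 = ZR j.2.2) ∧
        (∀ H : Set.Iic (ZR hc.le), (e.symm (OrderDual.toDual H) : M.Lat) = quot g H.1)) ∧
      (∃ e : Set.Icc (maxQuot g) h ≃o (Set.Iic (IR hc.le))ᵒᵈ,
        (∀ j : Set.Icc (maxQuot g) h,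
          (OrderDual.ofDual (e j)).1 = ZR j.2.2) ∧
        (∀ H : Set.Iic (IR hc.le), (e.symm (OrderDual.toDual H) : M.Lat) = quot h H.1))) := by
  refine ⟨fun _ _ hc₁ hc₂ => ZR_mul_ZR hc₁ hc₂,
    fun H K => ⟨quot_sup_quot g H K, quot_inf_quot g H K⟩, fun h hc => ⟨?_, ?_⟩⟩
  · exact ⟨galoisIso hc.maxQuot_le hc.le, fun _ => rfl, fun _ => rfl⟩
  · rw [IR_eq_ZR hc]
    -- The correspondence is applied with top `h` and bottom `∂g`. The latter need only lie above
    -- `∂h`, which is why `galoisIso` assumes an inequality rather than a central quotient.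
    exact ⟨galoisIso (maxQuot_mono hc.le) hc.maxQuot_le, fun _ => rfl, fun _ => rfl⟩
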